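/- Let $\mathcal T^{d}=(\mathbb R/\mathbb Z)^{d}$ be the $d$-dimensional unit torus with its flat Euclidean metric $\mathrm{dist}$ and the uniform probability measure, and let $v_d$ be the volume of the unit ball of $\mathbb R^d$. For $n\ge 1$ and $\alpha>0$ let $$r_n(\alpha)=2\Big(\frac{\alpha}{n v_d}\Big)^{1/d},$$ so that $n$ spheres of radius $r_n(\alpha)/2$ have density $n\,(r_n(\alpha)/2)^d\,v_d=\alpha$. The birthday inequality for the hard sphere model on $\mathcal T^d$ with $n$ spheres at density $\alpha$ is the inequality $$\Pr\big[\mathrm{dist}(X_i,X_j)>r \text{ for all } 1\le i<j\le n\big]\;\le\;(1-p)^{\binom n2},\qquad p=\Pr\big[\mathrm{dist}(X_1,X_2)\le r\big],$$ where $r=r_n(\alpha)$ and $X_1,X_2,\dots$ are independent and uniformly distributed in $\mathcal T^d$. **Theorem.** Let $d=24$ and $\rho=0.001929$. There is an $N$ such that for every $n\ge N$ and every $\alpha\in\big((0.79)^{24}\rho,\ \rho\big)$ the birthday inequality for the hard sphere model on $\mathcal T^{24}$ with $n$ spheres at density $\alpha$ fails, that is, $$\Pr\big[\mathrm{dist}(X_i,X_j)>r_n(\alpha)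 \text{ for all } 1\le i<j\le n\big]\;>\;(1-p)^{\binom n2}.$$ -/

import Mathlib

open MeasureTheory

noncomputable section

/-- The unit torus `(ℝ/ℤ)^d` with its flat Euclidean metric
`dist x y = √(∑ i, ‖x i - y i‖ ^ 2)`, where `‖·‖` is the distance to `0` in `ℝ/ℤ`. -/
abbrev UnitTorus (d : ℕ) : Type := PiLp 2 (fun _ : Fin d => UnitAddCircle)

/-- The uniform (Lebesgue) probability measure on the unit torus: the product of the Lebesgue
measures on the `d` circles of length one. -/
def torusMeasure (d : ℕ) : Measure (UnitTorus d) :=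
  Measure.map (WithLp.toLp 2) (Measure.pi fun _ : Fin d => (volume : Measure UnitAddCircle))

instance isProbabilityMeasure_torusMeasure (d : ℕ) : IsProbabilityMeasure (torusMeasure d) := by
  unfold torusMeasure
  have : IsProbabilityMeasure (volume : Measure UnitAddCircle) := ⟨UnitAddCircle.measure_univ⟩
  exact Measure.isProbabilityMeasure_map (WithLp.measurable_toLp 2 _).aemeasurable

/-- The probability that `n` independent points with distribution `μ` are at pairwise distance
greater than `r`, i.e. that their random geometric graph with threshold `r` has no edge. -/
def probEmpty {X : Type*} [PseudoMetricSpace X] [MeasurableSpace X] (μ : Measure X)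
    (n : ℕ) (r : ℝ) : ℝ :=
  (Measure.pi fun _ : Fin n => μ).real {x | ∀ i j : Fin n, i < j → r < dist (x i) (x j)}

/-- The probability that two independent points with distribution `μ` are at distance at
most `r`. -/
def probEdge {X : Type*} [PseudoMetricSpace X] [MeasurableSpace X] (μ : Measure X) (r : ℝ) : ℝ :=
  (μ.prod μ).real {x | dist x.1 x.2 ≤ r}

/-- The birthday inequality for `n` independent points with distribution `μ` and distance
threshold `r`. -/
def BirthdayInequality {X : Type*} [PseudoMetricSpace X] [MeasurableSpace X] (μ : Measure X)
    (n : ℕ) (r : ℝ) : Prop :=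
  probEmpty μ n r ≤ (1 - probEdge μ r) ^ n.choose 2

/-- The volume of the unit ball of `ℝ^d`. -/
def unitBallVolume (d : ℕ) : ℝ :=
  (volume : Measure (EuclideanSpace ℝ (Fin d))).real (Metric.ball 0 1)

/-- The distance threshold `r` at which `n` spheres of radius `r / 2` have density
`n * (r / 2) ^ d * v_d = α`, namely `r = 2 (α / (n v_d))^{1/d}`. -/
def hardSphereThreshold (d n : ℕ) (α : ℝ) : ℝ :=
  2 * (α / (n * unitBallVolume d)) ^ (1 / (d : ℝ))

/-- The birthday inequality for the hard sphere model on the unit torus of dimension `d` with `n`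
spheres at density `α`. -/
def HardSphereBirthdayInequality (d n : ℕ) (α : ℝ) : Prop :=
  BirthdayInequality (torusMeasure d) n (hardSphereThreshold d n α)

end

noncomputable section

/-- The word of the binary extended Golay code with message `a`: the multiple of the generator
polynomial of the cyclic Golay code (bits `0` to `22`) with coefficients the bits of `a`,
extended by a parity bit (bit `23`). -/
def golayEncode (a : ℕ) : ℕ :=
  (List.range 12).foldr (fun j w => (if a.testBit j then (0xC75 <<< j) ^^^ (1 <<< 23) else 0) ^^^ w) 0

/-- The `i`-th bit of `w`, as a number. -/
def bitVal (w i : ℕ) : ℕ := (w.testBit i).toNat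

/-- The number of ones among the first `24` bits. -/
def weight24 (w : ℕ) : ℕ := ((List.range 24).map fun i => (w >>> i) % 2).sum

theorem foldr_xor_testBit (f : ℕ → ℕ) (a b : ℕ) (l : List ℕ) :
    l.foldr (fun j w => (if (a ^^^ b).testBit j then f j else 0) ^^^ w) 0 =
      l.foldr (fun j w => (if a.testBit j then f j else 0) ^^^ w) 0 ^^^
        l.foldr (fun j w => (if b.testBit j then f j else 0) ^^^ w) 0 := by
  induction l with
  | nil => simp
  | cons j l ih =>
    have hj : (if (a ^^^ b).testBit j then f j else 0) =
        (if a.testBit j then f j else 0) ^^^ (if b.testBit j then f j else 0) := by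
      rw [Nat.testBit_xor]
      cases a.testBit j <;> cases b.testBit j <;> simp
    rw [List.foldr_cons, List.foldr_cons, List.foldr_cons, ih, hj]
    ac_rfl

theorem golayEncode_xor (a b : ℕ) :
    golayEncode (a ^^^ b) = golayEncode a ^^^ golayEncode b :=
  foldr_xor_testBit _ a b _

theorem golayEncode_weight :
    ∀ a < 4096, weight24 (golayEncode a) % 4 = 0 ∧ (a ≠ 0 → 8 ≤ weight24 (golayEncode a)) := by
  have h : ∀ b < 64, ∀ c < 64, weight24 (golayEncode (64 * b + c)) % 4 = 0 ∧
      (64 * b + c ≠ 0 → 8 ≤ weight24 (golayEncode (64 * b + c))) := by decide +kernel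
  intro a ha
  simpa only [Nat.div_add_mod] using h (a / 64) (by omega) (a % 64) (by omega)

theorem bitVal_eq (w i : ℕ) : bitVal w i = (w >>> i) % 2 := by
  rw [bitVal, Nat.testBit_eq_decide_div_mod_eq, Nat.shiftRight_eq_div_pow]
  rcases Nat.mod_two_eq_zero_or_one (w / 2 ^ i) with h | h <;> simp [h]

theorem sum_bitVal (w : ℕ) : ∑ i : Fin 24, bitVal w i = weight24 w := by
  rw [Fin.sum_univ_eq_sum_range (bitVal w) 24]
  simp only [bitVal_eq]
  rfl

theorem bitVal_le_one (w i : ℕ) : bitVal w i ≤ 1 := Bool.toNat_le _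

theorem bitVal_golayEncode_injective {a b : ℕ} (ha : a < 4096) (hb : b < 4096)
    (h : ∀ i : Fin 24, bitVal (golayEncode a) i = bitVal (golayEncode b) i) : a = b := by
  by_contra hne
  have hlt : a ^^^ b < 2 ^ 12 := Nat.xor_lt_two_pow ha hb
  have h8 := (golayEncode_weight _ hlt).2 (by simpa [Nat.xor_eq_zero_iff] using hne)
  rw [← sum_bitVal, Finset.sum_eq_zero] at h8
  · omega
  · intro i _
    have := h i
    simp only [bitVal] at this
    rw [bitVal, golayEncode_xor, Nat.testBit_xor]
    generalize (golayEncode a).testBit i = s at *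
    generalize (golayEncode b).testBit i = t at *
    cases s <;> cases t <;> simp_all

/-- An integer vector whose reduction modulo `2` is a word of the extended Golay code. -/
def IsGolay (y : Fin 24 → ℤ) : Prop :=
  ∃ a < 4096, ∀ i, (2 : ℤ) ∣ y i - bitVal (golayEncode a) i

theorem IsGolay.sub {y z : Fin 24 → ℤ} (hy : IsGolay y) (hz : IsGolay z) : IsGolay (y - z) := by
  obtain ⟨a, ha, hya⟩ := hy
  obtain ⟨b, hb, hzb⟩ := hz
  refine ⟨a ^^^ b, Nat.xor_lt_two_pow (n := 12) ha hb, fun i => ?_⟩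
  have h1 := hya i
  have h2 := hzb i
  rw [golayEncode_xor]
  simp only [bitVal, Nat.testBit_xor, Pi.sub_apply] at *
  generalize (golayEncode a).testBit i = s at *
  generalize (golayEncode b).testBit i = t at *
  cases s <;> cases t <;> simp at h1 h2 ⊢ <;> omega

theorem isGolay_of_even {y : Fin 24 → ℤ} (hy : ∀ i, (2 : ℤ) ∣ y i) : IsGolay y :=
  ⟨0, by norm_num, fun i => by simpa [bitVal, golayEncode] using hy i⟩

theorem isGolay_one : IsGolay 1 := by
  have h : ∀ i : Fin 24, bitVal (golayEncode 2787) i = 1 := by decide +kernel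
  exact ⟨2787, by norm_num, fun i => by rw [h i]; simp⟩

theorem IsGolay.add_const {y : Fin 24 → ℤ} (hy : IsGolay y) (m : ℤ) :
    IsGolay (fun i => y i + m) := by
  rcases Int.even_or_odd' m with ⟨c, rfl | rfl⟩
  · have := hy.sub (isGolay_of_even (y := fun _ => -(2 * c)) fun i => by simp)
    convert this using 1
    ext i; simp
  · have := (hy.sub isGolay_one).sub
      (isGolay_of_even (y := fun _ => -(2 * c + 2)) fun i => ⟨-(c + 1), by ring⟩)
    convert this using 1
    ext i; simp only [Pi.sub_apply, Pi.one_apply]; ring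

/-- The Leech lattice, scaled so that its coordinates are integers and its minimal norm is `32`. -/
def IsLeech (x : Fin 24 → ℤ) : Prop :=
  ∃ (m : ℤ) (y : Fin 24 → ℤ), (∀ i, x i = m + 2 * y i) ∧ IsGolay y ∧ (8 : ℤ) ∣ ∑ i, x i - 4 * m

theorem IsLeech.sub {x x' : Fin 24 → ℤ} (h : IsLeech x) (h' : IsLeech x') : IsLeech (x - x') := by
  obtain ⟨m, y, hx, hy, hs⟩ := h
  obtain ⟨m', y', hx', hy', hs'⟩ := h'
  refine ⟨m - m', y - y', fun i => ?_, hy.sub hy', ?_⟩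
  · simp [hx, hx']; ring
  · obtain ⟨q, hq⟩ := hs
    obtain ⟨q', hq'⟩ := hs'
    simp only [Pi.sub_apply, Finset.sum_sub_distrib]
    exact ⟨q - q', by linarith⟩

theorem isLeech_eight_mul (z : Fin 24 → ℤ) : IsLeech (fun i => 8 * z i) :=
  ⟨0, fun i => 4 * z i, fun i => by ring, isGolay_of_even fun i => ⟨2 * z i, by ring⟩,
    by rw [← Finset.mul_sum]; simp⟩

theorem two_le_sum_sq {w : Fin 24 → ℤ} (hw : w ≠ 0) (hs : (2 : ℤ) ∣ ∑ i, w i) :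
    2 ≤ ∑ i, w i ^ 2 := by
  have h2 : (2 : ℤ) ∣ ∑ i, w i ^ 2 - ∑ i, w i := by
    rw [← Finset.sum_sub_distrib]
    refine Finset.dvd_sum fun i _ => ?_
    have := Int.even_mul_pred_self (w i)
    rw [even_iff_two_dvd] at this
    convert this using 1; ring
  have hpos : 0 < ∑ i, w i ^ 2 := by
    obtain ⟨i, hi⟩ := Function.ne_iff.1 hw
    exact Finset.sum_pos' (fun i _ => sq_nonneg _) ⟨i, Finset.mem_univ i, sq_pos_of_ne_zero hi⟩
  omega

theorem IsGolay.eight_le_sum_sq {u : Fin 24 → ℤ} (hu : IsGolay u) (h0 : u ≠ 0)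
    (hs : (4 : ℤ) ∣ ∑ i, u i) : 8 ≤ ∑ i, u i ^ 2 := by
  obtain ⟨a, ha, hua⟩ := hu
  by_cases ha0 : a = 0
  · subst ha0
    have hu2 : ∀ i, (2 : ℤ) ∣ u i := fun i => by simpa [bitVal, golayEncode] using hua i
    choose w hw using hu2
    have hw0 : w ≠ 0 := by
      rintro rfl
      exact h0 (funext fun i => by simp [hw])
    simp only [hw, ← Finset.mul_sum, mul_pow] at hs ⊢
    have := two_le_sum_sq hw0 (by omega)
    omega
  · have h8 := (golayEncode_weight a ha).2 ha0
    rw [← sum_bitVal] at h8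
    calc (8 : ℤ) ≤ ∑ i : Fin 24, (bitVal (golayEncode a) i : ℤ) := by exact_mod_cast h8
      _ ≤ _ := by
        refine Finset.sum_le_sum fun i _ => ?_
        have h1 := hua i
        have h2 := bitVal_le_one (golayEncode a) i
        by_cases hz : u i = 0
        · rw [hz] at h1 ⊢
          norm_num; omega
        · have : 0 < u i ^ 2 := by positivity
          omega

theorem sum_sign_mul (s : ℤ) (b : Fin 24 → ℕ) :
    ∑ i, s * (1 - 2 * (b i : ℤ)) = s * (24 - 2 * ((∑ i, b i : ℕ) : ℤ)) := by
  rw [← Finset.mul_sum, Finset.sum_sub_distrib, ← Finset.mul_sum, Nat.cast_sum, Finset.sum_const,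
    Finset.card_univ, Fintype.card_fin, nsmul_eq_mul, mul_one, Nat.cast_ofNat]

theorem IsLeech.le_sum_sq {x : Fin 24 → ℤ} (hx : IsLeech x) (h0 : x ≠ 0) :
    32 ≤ ∑ i, x i ^ 2 := by
  obtain ⟨m, y, hxy, hy, hs⟩ := hx
  rcases Int.even_or_odd' m with ⟨c, rfl | rfl⟩
  · have hx2 : ∀ i, x i = 2 * (y i + c) := fun i => by rw [hxy]; ring
    have hu0 : (fun i => y i + c) ≠ 0 := fun h => h0 (funext fun i => by
      have := congrFun h i
      simp only [Pi.zero_apply] at this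
      simp [hx2, this])
    simp only [hx2, ← Finset.mul_sum, mul_pow] at hs ⊢
    have := (hy.add_const c).eight_le_sum_sq hu0 (by omega)
    linarith
  · by_contra hlt
    have h8 : ∀ i, (8 : ℤ) ∣ x i ^ 2 - 1 := fun i => by
      have hodd : Odd (x i) := ⟨c + y i, by rw [hxy]; ring⟩
      exact Int.eight_dvd_sq_sub_one_of_odd hodd
    have hnn : ∀ i, 0 ≤ x i ^ 2 - 1 := fun i => by
      have : x i ≠ 0 := by rw [hxy]; omega
      have : 0 < x i ^ 2 := by positivity
      omega
    have hsum : ∑ i, (x i ^ 2 - 1) < 8 := by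
      rw [Finset.sum_sub_distrib]; simp; omega
    have h1 : ∀ i, x i = 1 ∨ x i = -1 := fun i => by
      have hi := Finset.single_le_sum (fun j _ => hnn j) (Finset.mem_univ i)
      have := h8 i
      have := hnn i
      have : (x i - 1) * (x i + 1) = 0 := by
        have : x i ^ 2 - 1 = 0 := by omega
        linarith
      rcases mul_eq_zero.1 this with h | h <;> omega
    obtain ⟨a, ha, hya⟩ := hy
    have hw := (golayEncode_weight a ha).1
    rw [← sum_bitVal] at hw
    obtain ⟨s, hs1⟩ : ∃ s : ℤ, ∀ i, x i = s * (1 - 2 * bitVal (golayEncode a) i) := by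
      rcases Int.even_or_odd' c with ⟨e, rfl | rfl⟩
      · refine ⟨1, fun i => ?_⟩
        have := hya i
        have := hxy i
        have := bitVal_le_one (golayEncode a) i
        rcases h1 i with h | h <;> omega
      · refine ⟨-1, fun i => ?_⟩
        have := hya i
        have := hxy i
        have := bitVal_le_one (golayEncode a) i
        rcases h1 i with h | h <;> omega
    have hsx : ∑ i, x i = s * (24 - 2 * ((∑ i : Fin 24, bitVal (golayEncode a) i : ℕ) : ℤ)) := by
      simp only [hs1]
      exact sum_sign_mul s fun i => bitVal (golayEncode a) i
    obtain ⟨w, hw⟩ := Nat.dvd_of_mod_eq_zero hw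
    rw [hsx, hw] at hs
    obtain ⟨q, hq⟩ := hs
    have : s * (3 - w) * 8 - 8 * q - 8 * c = 4 := by
      push_cast at hq
      linarith
    omega

/-- Parameters of the points of the Leech lattice in the box `[0, 8k)^24`. -/
abbrev LeechParam (k : ℕ) : Type :=
  (Fin 2 × Fin 4096) × ((Fin 23 → Fin (2 * k)) × Fin k)

theorem card_leechParam (k : ℕ) : Fintype.card (LeechParam k) = 2 ^ 36 * k ^ 24 := by
  simp only [Fintype.card_prod, Fintype.card_fin, Fintype.card_fun]
  ring

def leechCoset (k : ℕ) (p : LeechParam k) : Fin 24 → ℕ :=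
  Fin.snoc (α := fun _ : Fin 24 => ℕ) (fun i : Fin 23 => (p.2.1 i : ℕ))
    (2 * (p.2.2 : ℕ) + (p.1.1 + ∑ i, (p.2.1 i : ℕ)) % 2)

def leechPoint (k : ℕ) (p : LeechParam k) (i : Fin 24) : ℕ :=
  p.1.1 + 2 * bitVal (golayEncode p.1.2) i + 4 * leechCoset k p i

theorem leechCoset_lt (k : ℕ) (p : LeechParam k) (i : Fin 24) : leechCoset k p i < 2 * k := by
  refine Fin.lastCases ?_ (fun j => ?_) i
  · simp only [leechCoset, Fin.snoc_last]
    have := p.2.2.2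
    omega
  · simp only [leechCoset, Fin.snoc_castSucc]
    exact (p.2.1 j).2

theorem leechPoint_lt (k : ℕ) (p : LeechParam k) (i : Fin 24) : leechPoint k p i < 8 * k := by
  have h1 := leechCoset_lt k p i
  have h2 := bitVal_le_one (golayEncode p.1.2) i
  have h3 := p.1.1.2
  unfold leechPoint
  omega

theorem isLeech_leechPoint (k : ℕ) (p : LeechParam k) :
    IsLeech (fun i => (leechPoint k p i : ℤ)) := by
  refine ⟨(p.1.1 : ℕ), fun i => bitVal (golayEncode p.1.2) i + 2 * leechCoset k p i,
    fun i => ?_, ⟨p.1.2, p.1.2.2, fun i => ?_⟩, ?_⟩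
  · simp only [leechPoint]; push_cast; ring
  · simp
  · have hw := (golayEncode_weight _ p.1.2.2).1
    rw [← sum_bitVal] at hw
    have hz : ∑ i, leechCoset k p i = ∑ i, (p.2.1 i : ℕ) +
        (2 * (p.2.2 : ℕ) + (p.1.1 + ∑ i, (p.2.1 i : ℕ)) % 2) := by
      rw [Fin.sum_univ_castSucc]
      simp only [leechCoset, Fin.snoc_castSucc, Fin.snoc_last]
    have hsum : ∑ i, leechPoint k p i = 24 * (p.1.1 : ℕ) +
        2 * ∑ i : Fin 24, bitVal (golayEncode p.1.2) i + 4 * ∑ i, leechCoset k p i := by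
      simp [leechPoint, Finset.sum_add_distrib, Finset.mul_sum]
    rw [← Nat.cast_sum, hsum]
    omega

theorem leechPoint_injective (k : ℕ) : Function.Injective (leechPoint k) := by
  rintro ⟨⟨m, a⟩, z, t⟩ ⟨⟨m', a'⟩, z', t'⟩ h
  have h := fun i => congrFun h i
  have hm : m = m' := by
    have := h 0
    simp only [leechPoint] at this
    have := m.2
    have := m'.2
    omega
  subst hm
  have ha : a = a' := by
    refine Fin.ext (bitVal_golayEncode_injective a.2 a'.2 fun i => ?_)
    have := h i
    simp only [leechPoint] at this
    have := bitVal_le_one (golayEncode a) i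
    have := bitVal_le_one (golayEncode a') i
    omega
  subst ha
  have hc : ∀ i, leechCoset k ((m, a), z, t) i = leechCoset k ((m, a), z', t') i := fun i => by
    have := h i
    simp only [leechPoint] at this
    omega
  have hz : z = z' := by
    funext j
    have := hc j.castSucc
    simp only [leechCoset, Fin.snoc_castSucc] at this
    exact Fin.ext this
  subst hz
  have ht : t = t' := by
    have := hc (Fin.last 23)
    simp only [leechCoset, Fin.snoc_last] at this
    exact Fin.ext (by omega)
  rw [ht]

/-- The image in the unit torus of the lattice point with parameter `p`, scaled by `1 / (8k)`. -/
def leechTorusPoint (k : ℕ) (p : LeechParam k) : UnitTorus 24 :=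
  WithLp.toLp 2 fun i => (((leechPoint k p i : ℝ) / (8 * k) : ℝ) : UnitAddCircle)

theorem le_dist_leechTorusPoint {k : ℕ} (hk : 0 < k) {p q : LeechParam k} (hpq : p ≠ q) :
    1 / (√2 * k) ≤ dist (leechTorusPoint k p) (leechTorusPoint k q) := by
  have hk' : (0 : ℝ) < k := by exact_mod_cast hk
  let R : Fin 24 → ℤ := fun i =>
    round ((leechPoint k p i : ℝ) / (8 * k) - (leechPoint k q i : ℝ) / (8 * k))
  let u : Fin 24 → ℤ := fun i => leechPoint k p i - leechPoint k q i - 8 * (k * R i)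
  have hu : IsLeech u :=
    ((isLeech_leechPoint k p).sub (isLeech_leechPoint k q)).sub (isLeech_eight_mul fun i => k * R i)
  have hu0 : u ≠ 0 := fun h => hpq (leechPoint_injective k (funext fun i => by
    have hi : (leechPoint k p i : ℤ) - leechPoint k q i - 8 * (k * R i) = 0 := congrFun h i
    have h1 := leechPoint_lt k p i
    have h2 := leechPoint_lt k q i
    have h3 : (leechPoint k p i : ℤ) - leechPoint k q i = 0 := by
      refine Int.eq_zero_of_abs_lt_dvd (m := 8 * k) ⟨R i, by linarith⟩ ?_
      rw [abs_lt]; omega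
    omega))
  have hd : dist (leechTorusPoint k p) (leechTorusPoint k q) =
      √(∑ i, ((u i : ℝ) / (8 * k)) ^ 2) := by
    rw [PiLp.dist_eq_of_L2]
    congr 1
    refine Finset.sum_congr rfl fun i _ => ?_
    rw [dist_eq_norm]
    simp only [leechTorusPoint]
    rw [← AddCircle.coe_sub, UnitAddCircle.norm_eq, sq_abs]
    congr 1
    simp only [u, R]
    push_cast
    field_simp
  rw [hd]
  apply Real.le_sqrt_of_sq_le
  have h32 : (32 : ℝ) ≤ ∑ i, (u i : ℝ) ^ 2 := by exact_mod_cast hu.le_sum_sq hu0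
  simp only [div_pow, ← Finset.sum_div]
  rw [mul_pow, Real.sq_sqrt zero_le_two, div_le_div_iff₀ (by positivity) (by positivity)]
  nlinarith [sq_nonneg (k : ℝ), mul_le_mul_of_nonneg_right h32 (sq_nonneg (k : ℝ))]

theorem exists_separated_unitTorus {n k : ℕ} (hk : 0 < k) (hn : n ≤ 2 ^ 36 * k ^ 24) :
    ∃ c : Fin n → UnitTorus 24, Pairwise fun i j => 1 / (√2 * k) ≤ dist (c i) (c j) := by
  obtain ⟨e⟩ := Function.Embedding.nonempty_of_card_le (α := Fin n) (β := LeechParam k)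
    (by simpa [-Fintype.card_prod, card_leechParam] using hn)
  exact ⟨fun i => leechTorusPoint k (e i), fun i j hij =>
    le_dist_leechTorusPoint hk (e.injective.ne hij)⟩

theorem norm_coe_unitAddCircle_le (x : ℝ) : ‖(x : UnitAddCircle)‖ ≤ |x| := by
  rw [UnitAddCircle.norm_eq]
  simpa using round_le x 0

/-- Balls of radius at most `1 / 2` in the unit torus have at least (in fact, exactly) the volume
of the Euclidean ball of the same radius. -/
theorem volume_ball_le_torusMeasure_ball {d : ℕ} (p : UnitTorus d) {r : ℝ} (hr : r ≤ 1 / 2) :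
    volume (Metric.ball (0 : EuclideanSpace ℝ (Fin d)) r) ≤
      torusMeasure d (Metric.ball p r) := by
  choose a ha using fun i => QuotientAddGroup.mk_surjective (p i)
  have hmp := measurePreserving_pi
    (fun i : Fin d => (volume : Measure ℝ).restrict (Set.Ioc (a i - 1 / 2) (a i - 1 / 2 + 1)))
    (fun _ : Fin d => (volume : Measure UnitAddCircle))
    (fun i => UnitAddCircle.measurePreserving_mk (a i - 1 / 2))
  have hm : MeasurableSet (WithLp.toLp 2 ⁻¹' Metric.ball p r : Set (Fin d → UnitAddCircle)) :=
    (WithLp.measurable_toLp 2 _) Metric.isOpen_ball.measurableSet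
  rw [torusMeasure, Measure.map_apply (WithLp.measurable_toLp 2 _) Metric.isOpen_ball.measurableSet,
    ← hmp.measure_preimage hm.nullMeasurableSet, ← Measure.restrict_pi_pi,
    Measure.restrict_apply (hmp.measurable hm),
    ← Measure.addHaar_ball_center volume (WithLp.toLp 2 a),
    ← (PiLp.volume_preserving_toLp (Fin d)).measure_preimage
      Metric.isOpen_ball.measurableSet.nullMeasurableSet, volume_pi]
  refine measure_mono fun x hx => ?_
  rw [Set.mem_preimage, Metric.mem_ball] at hx
  refine ⟨?_, fun i _ => ?_⟩
  · rw [Set.mem_preimage, Set.mem_preimage, Metric.mem_ball]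
    refine lt_of_le_of_lt ?_ hx
    rw [PiLp.dist_eq_of_L2, PiLp.dist_eq_of_L2]
    refine Real.sqrt_le_sqrt (Finset.sum_le_sum fun i _ => ?_)
    refine pow_le_pow_left₀ dist_nonneg ?_ 2
    rw [← ha i, dist_eq_norm, Real.dist_eq]
    exact norm_coe_unitAddCircle_le (x i - a i)
  · have h1 := PiLp.norm_apply_le (WithLp.toLp 2 x - WithLp.toLp 2 a) i
    rw [← dist_eq_norm] at h1
    have h2 : |x i - a i| < 1 / 2 := lt_of_le_of_lt h1 (hx.trans_le hr)
    rw [abs_lt] at h2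
    constructor <;> linarith [h2.1, h2.2]

theorem unitBallVolume_mul_pow_le {d : ℕ} (p : UnitTorus d) {r : ℝ} (hr0 : 0 < r)
    (hr : r ≤ 1 / 2) : unitBallVolume d * r ^ d ≤ (torusMeasure d).real (Metric.ball p r) := by
  have h := ENNReal.toReal_mono (measure_ne_top _ _) (volume_ball_le_torusMeasure_ball p hr)
  rw [Measure.addHaar_ball_of_pos _ _ hr0, ENNReal.toReal_mul, finrank_euclideanSpace_fin,
    ENNReal.toReal_ofReal (pow_nonneg hr0.le d)] at h
  rw [mul_comm]
  exact h

theorem one_sub_probEdge_pow_le {X : Type*} [PseudoMetricSpace X] [MeasurableSpace X]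
    (μ : Measure X) [IsProbabilityMeasure μ] {r β : ℝ} {n : ℕ} (hβ : β ≤ probEdge μ r) :
    (1 - probEdge μ r) ^ n.choose 2 ≤ Real.exp (-(β * (n - 1) / 2)) ^ n := by
  have h1 : probEdge μ r ≤ 1 := measureReal_le_one
  have hc : (0 : ℝ) ≤ n.choose 2 := Nat.cast_nonneg _
  calc (1 - probEdge μ r) ^ n.choose 2 ≤ Real.exp (-β) ^ n.choose 2 :=
        pow_le_pow_left₀ (by linarith) (by linarith [Real.add_one_le_exp (-β)]) _
    _ = _ := by
        rw [← Real.exp_nat_mul, ← Real.exp_nat_mul, Nat.cast_choose_two]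
        congr 1; ring

section Metric

variable {X : Type*} [PseudoMetricSpace X] [MeasurableSpace X] [OpensMeasurableSpace X]
  (μ : Measure X) [IsProbabilityMeasure μ]

theorem factorial_mul_pow_le_probEmpty {n : ℕ} {c : Fin n → X} {r ε β : ℝ} (hr : 0 ≤ r)
    (hc : Pairwise fun i j => r + 2 * ε ≤ dist (c i) (c j)) (hβ0 : 0 ≤ β)
    (hβ : ∀ i, β ≤ μ.real (Metric.ball (c i) ε)) :
    (n.factorial : ℝ) * β ^ n ≤ probEmpty μ n r := by
  have hsep : ∀ i j x y, i ≠ j → x ∈ Metric.ball (c i) ε → y ∈ Metric.ball (c j) ε →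
      r < dist x y := fun i j x y hij hx hy => by
    rw [Metric.mem_ball] at hx hy
    have h1 := dist_triangle4 (c i) x y (c j)
    rw [dist_comm (c i) x] at h1
    linarith [hc hij]
  let B : Equiv.Perm (Fin n) → Set (Fin n → X) := fun σ =>
    Set.univ.pi fun i => Metric.ball (c (σ i)) ε
  have hdisj : Pairwise (Function.onFun Disjoint B) := fun σ τ hστ => by
    obtain ⟨i, hi⟩ := DFunLike.ne_iff.1 hστ
    refine Set.disjoint_left.2 fun x hx hx' => ?_
    have := hsep _ _ _ _ hi (hx i trivial) (hx' i trivial)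
    rw [dist_self] at this
    exact hr.not_gt this
  have hB : ∀ σ, β ^ n ≤ (Measure.pi fun _ : Fin n => μ).real (B σ) := fun σ => by
    rw [Measure.real, Measure.pi_pi, ENNReal.toReal_prod]
    calc β ^ n = ∏ _i : Fin n, β := by simp
      _ ≤ _ := Finset.prod_le_prod (fun _ _ => hβ0) fun i _ => hβ _
  calc (n.factorial : ℝ) * β ^ n = ∑ _σ : Equiv.Perm (Fin n), β ^ n := by
        simp [Fintype.card_perm]
    _ ≤ ∑ σ, (Measure.pi fun _ : Fin n => μ).real (B σ) := Finset.sum_le_sum fun σ _ => hB σ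
    _ = (Measure.pi fun _ : Fin n => μ).real (⋃ σ ∈ Finset.univ, B σ) :=
        (measureReal_biUnion_finset (fun σ _ τ _ h => hdisj h) fun σ _ =>
          MeasurableSet.univ_pi fun i => Metric.isOpen_ball.measurableSet).symm
    _ ≤ probEmpty μ n r := by
        refine measureReal_mono fun x hx i j hij => ?_
        simp only [Finset.mem_univ, Set.iUnion_true, Set.mem_iUnion] at hx
        obtain ⟨σ, hσ⟩ := hx
        exact hsep _ _ _ _ (σ.injective.ne hij.ne) (hσ i trivial) (hσ j trivial)

theorem le_probEdge [SecondCountableTopology X] {r β : ℝ}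
    (hβ : ∀ x, β ≤ μ.real (Metric.ball x r)) : β ≤ probEdge μ r := by
  have hm : MeasurableSet {x : X × X | dist x.1 x.2 ≤ r} :=
    (isClosed_le continuous_dist continuous_const).measurableSet
  rw [probEdge, Measure.real, ← ENNReal.ofReal_le_iff_le_toReal (measure_ne_top _ _),
    Measure.prod_apply hm]
  calc ENNReal.ofReal β = ∫⁻ _x, ENNReal.ofReal β ∂μ := by simp
    _ ≤ _ := lintegral_mono fun x => by
      refine ENNReal.ofReal_le_of_le_toReal ((hβ x).trans (measureReal_mono fun y hy => ?_))
      rw [Metric.mem_ball, dist_comm] at hy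
      exact hy.le

end Metric

theorem unitBallVolume_twentyFour : unitBallVolume 24 = Real.pi ^ 12 / Nat.factorial 12 := by
  rw [unitBallVolume, Measure.real,
    InnerProductSpace.volume_ball_of_dim_even (k := 12) (by simp), ENNReal.ofReal_one, one_pow,
    one_mul, ENNReal.toReal_ofReal (by positivity)]

theorem unitBallVolume_twentyFour_bounds :
    0.0019295 < unitBallVolume 24 ∧ unitBallVolume 24 < 0.0019296 := by
  have h1 : (3.141592 : ℝ) ^ 12 < Real.pi ^ 12 :=
    pow_lt_pow_left₀ Real.pi_gt_d6 (by norm_num) (by norm_num)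
  have h2 : Real.pi ^ 12 < (3.141593 : ℝ) ^ 12 :=
    pow_lt_pow_left₀ Real.pi_lt_d6 Real.pi_pos.le (by norm_num)
  have h12 : ((Nat.factorial 12 : ℕ) : ℝ) = 479001600 := by norm_num [Nat.factorial]
  rw [unitBallVolume_twentyFour, h12, lt_div_iff₀ (by norm_num), div_lt_iff₀ (by norm_num)]
  constructor
  · refine lt_trans ?_ h1
    norm_num
  · refine h2.trans ?_
    norm_num

theorem exp_neg_natCast_le (m : ℕ) : Real.exp (-(m : ℝ)) ≤ 0.3679 ^ m := by
  have h : Real.exp (-(m : ℝ)) = Real.exp (-1) ^ m := by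
    rw [← Real.exp_nat_mul]; congr 1; ring
  rw [h]
  exact pow_le_pow_left₀ (Real.exp_pos _).le (by linarith [Real.exp_neg_one_lt_d9]) m

/-- The comparison between the volume in which one center may move and the penalty per center
in the birthday bound, in terms of the ratio `t` of the radius to that of the lattice packing. -/
theorem exp_le_one_sub_pow {t : ℝ} (hlo : 0.79 ^ 24 * 0.9996 ≤ t ^ 24)
    (hhi : t ^ 24 ≤ 0.9998) : Real.exp (8 - 16180 * t ^ 24) ≤ (1 - t) ^ 24 := by
  have key : ∀ m : ℕ, (0.3679 : ℝ) ^ m ≤ 1 - t → 8 + 24 * (m : ℝ) ≤ 16180 * t ^ 24 →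
      Real.exp (8 - 16180 * t ^ 24) ≤ (1 - t) ^ 24 := fun m h1 h2 =>
    calc Real.exp (8 - 16180 * t ^ 24) ≤ Real.exp ((24 : ℕ) * (-(m : ℝ))) := by
          rw [Real.exp_le_exp]; push_cast; linarith
      _ = Real.exp (-(m : ℝ)) ^ 24 := Real.exp_nat_mul _ _
      _ ≤ _ := pow_le_pow_left₀ (Real.exp_pos _).le ((exp_neg_natCast_le m).trans h1) _
  rcases le_total t 0.82 with h | h
  · refine key 2 (by norm_num at *; linarith) ?_
    refine le_trans ?_ (mul_le_mul_of_nonneg_left hlo (by norm_num))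
    norm_num
  rcases le_total t 0.9 with h' | h'
  · refine key 3 (by norm_num at *; linarith) ?_
    refine le_trans ?_ (mul_le_mul_of_nonneg_left (pow_le_pow_left₀ (by norm_num) h 24)
      (by norm_num))
    norm_num
  · refine key 12 ?_ ?_
    · have hb := one_add_mul_le_pow (a := t - 1) (by linarith) 24
      rw [add_sub_cancel] at hb
      push_cast at hb
      norm_num at *
      linarith
    · refine le_trans ?_ (mul_le_mul_of_nonneg_left (pow_le_pow_left₀ (by norm_num) h' 24)
        (by norm_num))
      norm_num

/-- The numbers `M * k ^ d` of points of the scaled lattices in the torus come just above any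
given large number. -/
theorem exists_lattice_scale {d M K n : ℕ} (hd : d ≠ 0) (hM : 0 < M) (hK : 0 < K)
    (hn : M * K ^ d < n) :
    ∃ k : ℕ, K < k ∧ n ≤ M * k ^ d ∧ (M * k ^ d : ℝ) ≤ (1 + 1 / K) ^ d * n := by
  have hex : ∃ k : ℕ, n ≤ M * k ^ d :=
    ⟨n, (Nat.le_self_pow hd n).trans (Nat.le_mul_of_pos_left _ hM)⟩
  classical
  have hk := Nat.find_spec hex
  have hmin := fun j => Nat.find_min (m := j) hex
  generalize Nat.find hex = k at hk hmin
  have hlt : K < k := by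
    by_contra hle
    have : M * k ^ d ≤ M * K ^ d :=
      Nat.mul_le_mul_left _ (Nat.pow_le_pow_left (not_lt.1 hle) _)
    exact absurd (hk.trans this) hn.not_ge
  obtain ⟨j, rfl⟩ : ∃ j, k = j + 1 := ⟨k - 1, by omega⟩
  refine ⟨j + 1, hlt, hk, ?_⟩
  have hj : M * j ^ d < n := not_le.1 (hmin j (Nat.lt_succ_self j))
  have hj' : (M * j ^ d : ℝ) ≤ n := by exact_mod_cast hj.le
  have hKj : (K : ℝ) ≤ j := by exact_mod_cast Nat.lt_succ_iff.1 hlt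
  have hK0 : (0 : ℝ) < K := by exact_mod_cast hK
  have h1 : ((j + 1 : ℕ) : ℝ) ≤ (1 + 1 / K) * j := by
    have : 1 ≤ (j : ℝ) / K := (one_le_div hK0).2 hKj
    push_cast
    calc (j : ℝ) + 1 ≤ j + j / K := by linarith
      _ = _ := by ring
  calc (M * ((j + 1 : ℕ) : ℝ) ^ d) ≤ M * ((1 + 1 / K) * j) ^ d := by gcongr
    _ = (1 + 1 / K) ^ d * (M * (j : ℝ) ^ d) := by rw [mul_pow]; ring
    _ ≤ (1 + 1 / K) ^ d * n := by gcongr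

/-- If the unit torus contains `n` points at pairwise distance at least `D`, then `n` random points
are at pairwise distance greater than `r` with at least the probability that they fall, in some
order, into the balls of radius `(D - r) / 2` around these. -/
theorem pow_le_probEmpty_torusMeasure {d n : ℕ} {c : Fin n → UnitTorus d} {r D : ℝ} (hr : 0 ≤ r)
    (hrD : r < D) (hD : D ≤ 1) (hc : Pairwise fun i j => D ≤ dist (c i) (c j)) :
    (n * (unitBallVolume d * ((D - r) / 2) ^ d) * Real.exp (-1)) ^ n ≤
      probEmpty (torusMeasure d) n r := by
  have hv : 0 ≤ unitBallVolume d := measureReal_nonneg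
  have hε : 0 < (D - r) / 2 := by linarith
  refine le_trans ?_ (factorial_mul_pow_le_probEmpty (torusMeasure d) (c := c)
    (ε := (D - r) / 2) hr (fun i j hij => by linarith [hc hij]) (by positivity)
    fun i => unitBallVolume_mul_pow_le (c i) hε (by linarith))
  have hfac := Real.pow_div_factorial_le_exp (n : ℝ) (Nat.cast_nonneg n) n
  rw [div_le_iff₀ (by positivity)] at hfac
  have he : Real.exp n * Real.exp (-1) ^ n = 1 := by
    rw [← Real.exp_nat_mul, ← Real.exp_add]; simp
  have hβ : 0 ≤ unitBallVolume d * ((D - r) / 2) ^ d := by positivity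
  generalize unitBallVolume d * ((D - r) / 2) ^ d = β at *
  calc (n * β * Real.exp (-1)) ^ n = (n : ℝ) ^ n * (β ^ n * Real.exp (-1) ^ n) := by ring
    _ ≤ Real.exp n * n.factorial * (β ^ n * Real.exp (-1) ^ n) := by gcongr
    _ = n.factorial * β ^ n * (Real.exp n * Real.exp (-1) ^ n) := by ring
    _ = _ := by rw [he, mul_one]

theorem probEdge_pow_le_torusMeasure {d n : ℕ} {r : ℝ} (hr0 : 0 < r) (hr : r ≤ 1 / 2) :
    (1 - probEdge (torusMeasure d) r) ^ n.choose 2 ≤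
      Real.exp (-(unitBallVolume d * r ^ d * (n - 1) / 2)) ^ n :=
  one_sub_probEdge_pow_le _ (le_probEdge _ fun x => unitBallVolume_mul_pow_le x hr0 hr)

theorem hardSphereThreshold_pow {d n : ℕ} (hd : d ≠ 0) {α : ℝ} (hα : 0 ≤ α) :
    hardSphereThreshold d n α ^ d = 2 ^ d * (α / (n * unitBallVolume d)) := by
  have hv : 0 ≤ unitBallVolume d := measureReal_nonneg
  rw [hardSphereThreshold, mul_pow, one_div, Real.rpow_inv_natCast_pow (by positivity) hd]

end

theorem mainTheorem2 :
    ∃ N : ℕ, ∀ n : ℕ, N ≤ n → ∀ α : ℝ,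
      α ∈ Set.Ioo ((0.79 : ℝ) ^ 24 * 0.001929) 0.001929 →
        ¬ HardSphereBirthdayInequality 24 n α := by
  refine ⟨2 ^ 36 * (10 ^ 6) ^ 24 + 1, fun n hn α ⟨hα1, hα2⟩ h => ?_⟩
  obtain ⟨k, hk, hnk, hkn⟩ := exists_lattice_scale (d := 24) (M := 2 ^ 36) (K := 10 ^ 6) (by norm_num)
    (by norm_num) (by norm_num) hn
  obtain ⟨c, hc⟩ := exists_separated_unitTorus (lt_trans (by norm_num) hk) hnk
  obtain ⟨hv1, hv2⟩ := unitBallVolume_twentyFour_bounds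
  have hα0 : 0 < α := lt_trans (by norm_num) hα1
  have hv0 : 0 < unitBallVolume 24 := lt_trans (by norm_num) hv1
  have hn6 : 10 ^ 6 ≤ n := le_trans (by norm_num) hn
  have hn6' : (10 ^ 6 : ℝ) ≤ n := by exact_mod_cast hn6
  have hn0 : (0 : ℝ) < n := lt_of_lt_of_le (by norm_num) hn6'
  have hk6 : (10 ^ 6 : ℝ) < k := by exact_mod_cast hk
  have hk0 : (0 : ℝ) < k := lt_trans (by norm_num) hk6
  have hnk' : (n : ℝ) ≤ 2 ^ 36 * k ^ 24 := by exact_mod_cast hnk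
  have hkn' : (2 ^ 36 * k ^ 24 : ℝ) ≤ 1.00003 * n := by
    push_cast at hkn
    have h : (1 + 1 / 10 ^ 6 : ℝ) ^ 24 ≤ 1.00003 := by norm_num
    linarith [mul_le_mul_of_nonneg_right h hn0.le]
  have hr24 := hardSphereThreshold_pow (n := n) (d := 24) (by norm_num) hα0.le
  have hr0 : 0 < hardSphereThreshold 24 n α := by
    unfold hardSphereThreshold
    positivity
  unfold HardSphereBirthdayInequality BirthdayInequality at h
  generalize hardSphereThreshold 24 n α = r at *
  have hD0 : 0 < 1 / (√2 * k) := by positivity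
  have hD24 : (1 / (√2 * k)) ^ 24 * (2 ^ 12 * (k : ℝ) ^ 24) = 1 := by
    have h2 : √2 ^ 24 = (2 : ℝ) ^ 12 := by
      rw [show 24 = 2 * 12 from rfl, pow_mul, Real.sq_sqrt zero_le_two]
    rw [div_pow, mul_pow, h2, one_pow, one_div_mul_cancel (by positivity)]
  have hD2 : 1 / (√2 * k) ≤ 1 / 2 := by
    refine one_div_le_one_div_of_le two_pos ?_
    have : 1 ≤ √2 := Real.one_le_sqrt.2 one_le_two
    nlinarith
  generalize 1 / (√2 * k) = D at *
  obtain ⟨t, rfl⟩ : ∃ t, r = t * D := ⟨r / D, by field_simp⟩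
  have ht0 : 0 < t := pos_of_mul_pos_left hr0 hD0.le
  -- `w` is the density of the lattice packing, up to the rounding of the number of points.
  obtain ⟨w, hw⟩ : ∃ w, w = n * unitBallVolume 24 / (2 ^ 36 * k ^ 24) := ⟨_, rfl⟩
  have hwA : w * (2 ^ 36 * k ^ 24) = n * unitBallVolume 24 := by
    rw [hw]; field_simp
  have hw1 : 0.00192944 ≤ w := by
    rw [hw, le_div_iff₀ (by positivity)]
    nlinarith
  have hw2 : w ≤ 0.0019296 := by
    rw [hw, div_le_iff₀ (by positivity)]
    nlinarith
  have htα : t ^ 24 * w = α := by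
    rw [mul_pow, eq_comm, ← mul_div_assoc, div_eq_iff (by positivity)] at hr24
    rw [← hwA] at hr24
    have : (2 : ℝ) ^ 24 * (t ^ 24 * w) = 2 ^ 24 * α := by
      calc (2 : ℝ) ^ 24 * (t ^ 24 * w)
          = t ^ 24 * (2 ^ 24 * w) * (D ^ 24 * (2 ^ 12 * (k : ℝ) ^ 24)) := by rw [hD24]; ring
        _ = t ^ 24 * D ^ 24 * (w * (2 ^ 36 * k ^ 24)) := by ring
        _ = 2 ^ 24 * α := hr24.symm
    exact mul_left_cancel₀ (by positivity) this
  have ht24 : 0 < t ^ 24 := by positivity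
  have hlo : 0.79 ^ 24 * 0.9996 ≤ t ^ 24 := by
    by_contra! hlt
    have : t ^ 24 * w < 0.79 ^ 24 * 0.001929 := by
      calc t ^ 24 * w ≤ 0.79 ^ 24 * 0.9996 * 0.0019296 := by gcongr
        _ < _ := by norm_num
    linarith
  have hhi : t ^ 24 ≤ 0.9998 := by
    by_contra! hlt
    nlinarith
  have ht1 : t < 1 := by
    by_contra! hle
    linarith [one_le_pow₀ hle (n := 24)]
  have hrD : t * D < D := by nlinarith
  have hmain := (pow_le_probEmpty_torusMeasure hr0.le hrD (by linarith) hc).trans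
    (h.trans (probEdge_pow_le_torusMeasure hr0 (by linarith)))
  have hmain := (pow_le_pow_iff_left₀ (by positivity) (Real.exp_pos _).le
    (by omega : n ≠ 0)).1 hmain
  have hβ : n * (unitBallVolume 24 * ((D - t * D) / 2) ^ 24) = w * (1 - t) ^ 24 := by
    calc n * (unitBallVolume 24 * ((D - t * D) / 2) ^ 24)
        = n * unitBallVolume 24 * (D ^ 24 * ((1 - t) / 2) ^ 24) := by ring
      _ = w * ((1 - t) ^ 24) * (D ^ 24 * (2 ^ 12 * (k : ℝ) ^ 24)) := by rw [← hwA]; ring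
      _ = _ := by rw [hD24, mul_one]
  have hE : 16180 * t ^ 24 ≤ unitBallVolume 24 * (t * D) ^ 24 * (n - 1) / 2 := by
    have h1 : unitBallVolume 24 * (t * D) ^ 24 * (n - 1) / 2 =
        2 ^ 23 * (t ^ 24 * w) * ((n - 1) / n) := by
      rw [htα, hr24]; field_simp
    have h2 : 0.9999 ≤ ((n : ℝ) - 1) / n := by
      rw [le_div_iff₀ hn0]; linarith
    calc 16180 * t ^ 24 ≤ 2 ^ 23 * (t ^ 24 * 0.00192944) * 0.9999 := by
          linarith
      _ ≤ 2 ^ 23 * (t ^ 24 * w) * ((n - 1) / n) := by gcongr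
      _ = _ := h1.symm
  rw [hβ] at hmain
  have hw7 : Real.exp (-7) < w :=
    (exp_neg_natCast_le 7).trans_lt (lt_of_lt_of_le (by norm_num) hw1)
  refine hmain.not_gt ?_
  calc _ ≤ Real.exp (-(16180 * t ^ 24)) := Real.exp_le_exp.2 (by linarith)
    _ = Real.exp (-7) * Real.exp (8 - 16180 * t ^ 24) * Real.exp (-1) := by
        rw [← Real.exp_add, ← Real.exp_add]; congr 1; ring
    _ < w * Real.exp (8 - 16180 * t ^ 24) * Real.exp (-1) := by gcongr
    _ ≤ w * (1 - t) ^ 24 * Real.exp (-1) := by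
        gcongr
        exact exp_le_one_sub_pow hlo hhi
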